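/- Let $S\subset\mathbb Z$ be a set of integers with $\max S=1$, let $\ell\le 0\le r$ be integers, and let $(n_i)_{\ell\le i\le r}$ be positive integers, with $n_i=0$ for $i<\ell$ or $i>r$. Assume that $\min S=-1$ or $\ell=0$. Let $x_{i,s}$ ($i,s\in\mathbb Z$) be indeterminates. Let $V=\bigcup_{i=\ell}^r V_i$ with $V_i=\{i^1,\dots,i^{n_i}\}$, and let $K$ be the digraph on $V$ with an arc from $i^p$ to $j^q$ if and only if $i^p\neq j^q$ and $j=i-s$ for some $s\in S$; this arc has weight $x_{i,s}$. Spanning trees of $K$ are rooted, with all arcs pointing towards the root, and the weight of a tree is the product of the weights of its arcs. (1) If $\ell<r$, the generating function of the spanning trees of $K$ rooted at $0^{n_0}$ equals $$\Bigl(\prod_{i=\ell}^{-1}x_{i,-1}\Bigr)\Bigl(\prod_{i=1}^{r}x_{i,1}\Bigr)\Bigl(\prod_{i=\ell+1}^{r-1}n_i\Bigr)\prod_{i=\ell}^{r}\Bigl(\sum_{s\in S}n_{i-s}x_{i,s}\Bigr)^{n_i-1}.$$ If $\ell=r=0$, then $n_0$ times this generating function equals $\bigl(\sum_{s\in S}n_{-s}x_{0,s}\bigr)^{n_0-1}$.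 (2) Let $n=\sum_{i=\ell}^r n_i$. An $S$-embedded Cayley tree of size $n$ is a rooted tree on a fixed set of $n$ labelled vertices, together with an integer abscissa $a(v)$ for every vertex $v$, such that the root has abscissa $0$ and $a(v')-a(v)\in S$ whenever $v'$ is a child of $v$. The generating function of the $S$-embedded Cayley trees having exactly $n_i$ vertices at abscissa $i$ for every $i$, where each non-root vertex at abscissa $i$ whose parent is at abscissa $i-s$ contributes a factor $x_{i,s}$, equals $$\frac{n_0}{n_\ell n_r}\,\frac{n!}{\prod_{i=\ell}^r(n_i-1)!}\,\prod_{i=\ell}^{-1}x_{i,-1}\,\prod_{i=1}^{r}x_{i,1}\,\prod_{i=\ell}^{r}\Bigl(\sum_{s\in S}n_{i-s}x_{i,s}\Bigr)^{n_i-1}.$$ -/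

import Mathlib

/-- A rooted tree on the vertex set `V` with root `ρ`, given by the finite set `T` of its arcs, all
pointing towards the root (an arc `(u, v)` says that `v` is the parent of `u`): no arc leaves the
root, exactly one arc leaves every other vertex, and from every vertex the arcs lead to the root. -/
structure IsRootedTree {V : Type*} (ρ : V) (T : Finset (V × V)) : Prop where
  root_out : ∀ v, (ρ, v) ∉ T
  existsUnique_parent : ∀ u, u ≠ ρ → ∃! v, (u, v) ∈ T
  reaches_root : ∀ u, Relation.ReflTransGen (fun a b => (a, b) ∈ T) u ρ

/-- `T` is (the arc set of) a spanning tree of the digraph `K`, rooted at `ρ`, with all arcs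
pointing towards `ρ`. -/
def IsSpanningTree {V : Type*} (K : Digraph V) (ρ : V) (T : Finset (V × V)) : Prop :=
  IsRootedTree ρ T ∧ ∀ e ∈ T, K.Adj e.1 e.2

open Classical in
/-- The generating function of the spanning trees of `K` rooted at `ρ`, where the arc from `u` to
`v` has weight `w u v` and the weight of a tree is the product of the weights of its arcs. -/
noncomputable def spanningTreeGF {V R : Type*} [Fintype V] [CommSemiring R] (K : Digraph V)
    (w : V → V → R) (ρ : V) : R :=
  ∑ T : Finset (V × V) with IsSpanningTree K ρ T, ∏ e ∈ T, w e.1 e.2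

/-- The vertex set `V = ⋃ V_i` (`ℓ ≤ i ≤ r`), with `V_i = {i^1, …, i^{n_i}}`; the vertex `i^p` is
the pair `⟨i, p - 1⟩`. -/
abbrev ProfileVertex (ℓ r : ℤ) (n : ℤ → ℕ) : Type :=
  Σ i : Finset.Icc ℓ r, Fin (n i)

/-- The vertex `0^{n_0}`. -/
def lastZeroVertex {ℓ r : ℤ} {n : ℤ → ℕ} (hℓ : ℓ ≤ 0) (hr : 0 ≤ r) (h : 0 < n 0) :
    ProfileVertex ℓ r n :=
  ⟨⟨0, Finset.mem_Icc.2 ⟨hℓ, hr⟩⟩, ⟨n 0 - 1, Nat.sub_lt h Nat.one_pos⟩⟩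

/-- The digraph `K`: there is an arc from `i^p` to `j^q` if and only if `i^p ≠ j^q` and
`j = i - s` for some `s ∈ S`. -/
def profileDigraph (S : Set ℤ) (ℓ r : ℤ) (n : ℤ → ℕ) : Digraph (ProfileVertex ℓ r n) where
  Adj u v := u ≠ v ∧ ∃ s ∈ S, (v.1 : ℤ) = (u.1 : ℤ) - s

/-- The indeterminate `x_{i,s}`. -/
noncomputable abbrev outVar (i s : ℤ) : MvPolynomial (ℤ × ℤ) ℚ := MvPolynomial.X (i, s)

/-- `(ρ, T, a)` is an `S`-embedded Cayley tree: a rooted tree with root `ρ` and child-to-parent arc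
set `T`, and an abscissa `a v` for every vertex `v`, such that the root has abscissa `0` and the
abscissa of a child minus that of its parent lies in `S`. -/
structure IsEmbeddedTree {V : Type*} (S : Set ℤ) (ρ : V) (T : Finset (V × V)) (a : V → ℤ) :
    Prop where
  isRootedTree : IsRootedTree ρ T
  abscissa_root : a ρ = 0
  step_mem : ∀ e ∈ T, a e.1 - a e.2 ∈ S

/-- For every integer `i`, exactly `n i` vertices lie at abscissa `i`. -/
def HasProfile {V : Type*} [Fintype V] (a : V → ℤ) (n : ℤ → ℕ) : Prop :=
  ∀ i : ℤ, (Finset.univ.filter fun v => a v = i).card = n i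

/-- The number of vertices of a tree of profile `(n_ℓ, …, n_r)`. -/
noncomputable def profileSize (ℓ r : ℤ) (n : ℤ → ℕ) : ℕ := ∑ i ∈ Finset.Icc ℓ r, n i

open Classical in
/-- The generating function of the `S`-embedded Cayley trees of vertical profile `(n_ℓ, …, n_r)` on
the label set `Fin (n_ℓ + ⋯ + n_r)`, where every non-root vertex of abscissa `i` whose parent has
abscissa `i - s` contributes a factor `x_{i,s}`. The sum is over all triples `(ρ, T, a)`. -/
noncomputable def embeddedCayleyTreeGF (S : Set ℤ) (ℓ r : ℤ) (n : ℤ → ℕ) :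
    MvPolynomial (ℤ × ℤ) ℚ :=
  ∑ ρ : Fin (profileSize ℓ r n), ∑ T : Finset (Fin (profileSize ℓ r n) × Fin (profileSize ℓ r n)),
    ∑ a ∈ Fintype.piFinset (fun _ : Fin (profileSize ℓ r n) => Finset.Icc ℓ r) with
        IsEmbeddedTree S ρ T a ∧ HasProfile a n,
      ∏ e ∈ T, outVar (a e.1) (a e.1 - a e.2)

/-- The polynomial `∑_{s ∈ S} n_{i-s} x_{i,s}`, a finite sum when `n` has finite support. -/
noncomputable def outSum (S : Set ℤ) (n : ℤ → ℕ) (i : ℤ) : MvPolynomial (ℤ × ℤ) ℚ :=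
  ∑ᶠ s ∈ S, (n (i - s) : MvPolynomial (ℤ × ℤ) ℚ) * outVar i s

/-! Trees are encoded by parent functions, and the matrix-tree theorem (`det_rootedLaplacian`) turns
their generating function into a determinant. The weight of an arc depends only on the abscissas of
its ends, so the Laplacian is a diagonal matrix minus a product factoring through the set of
abscissas. A Schur complement (`det_rootedLaplacian_comp_mul`) and a column manipulation
(`mul_det_laplacian_sub_col`) reduce it to a Laplacian on `{ℓ, …, r}`, whose weights are multiplied
by the class size of the target; the reduction contributes the powers `n i - 1` of the out-sums
(`card_mul_parentGF_comp`).

On `{ℓ, …, r}` no arc of nonzero weight moves towards `0` by more than one, so the only tree rooted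
at `0` that contributes is the path in which every vertex steps towards `0` (`parentGF_Icc`).

For Cayley trees, fix the abscissa function first. Each of the `n 0` possible roots gives the same
sum, and the number of abscissa functions of a given profile is multinomial (`card_hasProfile`). -/

/-! ### The matrix-tree theorem for weighted digraphs. -/

/-- Every orbit of `f` ends in the fixed point `ρ`. -/
def IsRootedAt {V : Type*} (ρ : V) (f : V → V) : Prop :=
  f ρ = ρ ∧ ∀ u, ∃ k : ℕ, f^[k] u = ρ

open Classical in
/-- The generating function of the parent functions of trees on `V` rooted at `ρ`. -/
noncomputable def parentGF {V R : Type*} [Fintype V] [DecidableEq V] [CommSemiring R] (w : V → V → R) (ρ : V) : R :=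
  ∑ f : V → V with IsRootedAt ρ f, ∏ u with u ≠ ρ, w u (f u)

/-- The Laplacian matrix of the weights `w`, its row `ρ` replaced by a standard basis vector. -/
def rootedLaplacian {V R : Type*} [Fintype V] [DecidableEq V] [CommRing R] (w : V → V → R)
    (ρ : V) : Matrix V V R :=
  Matrix.of fun u v => if u = ρ then (if u = v then 1 else 0) else
    (if u = v then ∑ z, w u z else 0) - w u v

/-- The Laplacian matrix of the functional graph of `f`, with the arc leaving `ρ` deleted. -/
def functionalLaplacian {V R : Type*} [DecidableEq V] [CommRing R] (ρ : V)
    (f : V → V) : Matrix V V R :=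
  Matrix.of fun u v => (if u = v then 1 else 0) - if u ≠ ρ ∧ f u = v then 1 else 0

/-- Each arc strictly decreases the distance to `ρ`, so ordering the vertices by this distance makes
the matrix block triangular with identity diagonal blocks. -/
theorem det_functionalLaplacian_eq_one {V R : Type*} [Fintype V] [DecidableEq V] [CommRing R]
    {ρ : V} {f : V → V} (hf : IsRootedAt ρ f) :
    (functionalLaplacian ρ f : Matrix V V R).det = 1 := by
  classical
  have hdec : ∀ u, u ≠ ρ → Nat.find (hf.2 (f u)) < Nat.find (hf.2 u) := by
    intro u hu
    obtain ⟨k, hk⟩ : ∃ k, Nat.find (hf.2 u) = k + 1 := by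
      refine Nat.exists_eq_succ_of_ne_zero fun h0 => hu ?_
      have := Nat.find_spec (hf.2 u)
      rwa [h0] at this
    have h1 := Nat.find_spec (hf.2 u)
    rw [hk, Function.iterate_succ_apply] at h1
    rw [hk]
    exact Nat.lt_succ_of_le (Nat.find_min' _ h1)
  have htri : (functionalLaplacian ρ f : Matrix V V R).BlockTriangular
      (fun u => OrderDual.toDual (Nat.find (hf.2 u))) := by
    intro u v huv
    have huv' : Nat.find (hf.2 u) < Nat.find (hf.2 v) := huv
    have h1 : u ≠ v := by rintro rfl; exact lt_irrefl _ huv'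
    have h2 : ¬ (u ≠ ρ ∧ f u = v) := by
      rintro ⟨hu, rfl⟩
      exact lt_asymm huv' (hdec u hu)
    rw [functionalLaplacian, Matrix.of_apply, if_neg h1, if_neg h2, sub_zero]
  rw [htri.det]
  refine Finset.prod_eq_one fun d _ => ?_
  suffices h : (functionalLaplacian ρ f : Matrix V V R).toSquareBlock
      (fun u => OrderDual.toDual (Nat.find (hf.2 u))) d = 1 by rw [h, Matrix.det_one]
  ext ⟨u, hu⟩ ⟨v, hv⟩
  have h2 : ¬ (u ≠ ρ ∧ f u = v) := by
    rintro ⟨hu', rfl⟩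
    have : Nat.find (hf.2 u) = Nat.find (hf.2 (f u)) := hu.trans hv.symm
    exact (hdec u hu').ne' this
  simp only [Matrix.toSquareBlock_def, Matrix.of_apply, functionalLaplacian, if_neg h2, sub_zero,
    Matrix.one_apply, Subtype.mk.injEq]

/-- The indicator of the vertices that never reach `ρ` is constant along arcs and vanishes at `ρ`:
it is a nonzero kernel vector. -/
theorem det_functionalLaplacian_eq_zero {V R : Type*} [Fintype V] [DecidableEq V] [CommRing R]
    [IsDomain R] {ρ : V} {f : V → V} (hρ : f ρ = ρ) (hf : ¬ IsRootedAt ρ f) :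
    (functionalLaplacian ρ f : Matrix V V R).det = 0 := by
  classical
  have hex : ∃ u, ¬ ∃ k : ℕ, f^[k] u = ρ := by
    by_contra! h
    exact hf ⟨hρ, h⟩
  obtain ⟨u₀, hu₀⟩ := hex
  rw [← Matrix.exists_mulVec_eq_zero_iff]
  refine ⟨fun u => if ∃ k : ℕ, f^[k] u = ρ then 0 else 1, fun h => ?_, ?_⟩
  · have := congrFun h u₀
    simp [hu₀] at this
  · ext u
    have hiff : u ≠ ρ → ((∃ k : ℕ, f^[k] (f u) = ρ) ↔ ∃ k : ℕ, f^[k] u = ρ) := by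
      refine fun hu => ⟨fun ⟨k, hk⟩ => ⟨k + 1, hk⟩, ?_⟩
      rintro ⟨k, hk⟩
      cases k with
      | zero => exact absurd hk hu
      | succ k => exact ⟨k, hk⟩
    simp only [Matrix.mulVec, dotProduct, functionalLaplacian, Matrix.of_apply, sub_mul, ite_mul,
      one_mul, zero_mul, Finset.sum_sub_distrib, Finset.sum_ite_eq, Finset.mem_univ, if_true,
      Pi.zero_apply]
    by_cases hu : u = ρ
    · subst hu
      simp only [ne_eq, not_true_eq_false, false_and, if_false, Finset.sum_const_zero, sub_zero]
      exact if_pos ⟨0, rfl⟩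
    · simp only [ne_eq, hu, not_false_eq_true, true_and, Finset.sum_ite_eq, Finset.mem_univ,
        if_true, hiff hu, sub_self]

/-- The matrix-tree theorem for weighted digraphs. -/
theorem det_rootedLaplacian {V R : Type*} [Fintype V] [DecidableEq V] [CommRing R] [IsDomain R]
    (w : V → V → R) (ρ : V) : (rootedLaplacian w ρ).det = parentGF w ρ := by
  classical
  -- Row `u ≠ ρ` is the combination of the vectors `e_u - e_z` with coefficients `w u z`. The
  -- convention for row `ρ` kills every function that does not fix `ρ` once the determinant is
  -- expanded by multilinearity.
  let c : V → V → R := fun u v => if u = ρ then (if v = ρ then 1 else 0) else w u v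
  have hrow : rootedLaplacian w ρ = fun u => ∑ z, c u z •
      (fun v => (if u = v then 1 else 0) - if u ≠ ρ ∧ z = v then 1 else 0 : V → R) := by
    ext u v
    by_cases hu : u = ρ
    · simp [rootedLaplacian, c, hu, Finset.sum_apply, ite_apply]
    · simp [rootedLaplacian, c, hu, mul_sub, Finset.sum_sub_distrib]
  have hexp : (rootedLaplacian w ρ).det =
      ∑ f : V → V, (∏ u, c u (f u)) * (functionalLaplacian ρ f : Matrix V V R).det := by
    rw [hrow]
    have h := (Matrix.detRowAlternating (n := V) (R := R)).toMultilinearMap.map_sum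
      (fun u z => c u z •
        (fun v => (if u = v then 1 else 0) - if u ≠ ρ ∧ z = v then 1 else 0 : V → R))
    refine h.trans (Finset.sum_congr rfl fun f _ => ?_)
    exact (Matrix.detRowAlternating (n := V) (R := R)).toMultilinearMap.map_smul_univ
      (fun u => c u (f u)) _
  have hprod : ∀ f : V → V, f ρ = ρ → ∏ u, c u (f u) = ∏ u with u ≠ ρ, w u (f u) := by
    intro f hf
    rw [Finset.prod_filter]
    refine Finset.prod_congr rfl fun u _ => ?_
    by_cases hu : u = ρ
    · simp [c, hu, hf]
    · simp [c, hu]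
  rw [hexp, parentGF, Finset.sum_filter]
  refine Finset.sum_congr rfl fun f _ => ?_
  split_ifs with hf
  · rw [det_functionalLaplacian_eq_one hf, mul_one, hprod f hf.1]
  · by_cases hρ : f ρ = ρ
    · rw [det_functionalLaplacian_eq_zero hρ hf, mul_zero]
    · rw [Finset.prod_eq_zero (Finset.mem_univ ρ) (by simp [c, hρ]), zero_mul]

/-! ### Counting maps with prescribed fibre sizes. -/

/-- Orbit-stabilizer for permutations acting by precomposition: the orbit of `a₀` consists of the
maps with its fibre sizes, and its stabilizer is a product of symmetric groups. -/
theorem card_filter_card_fiber_eq {α ι : Type*} [Fintype α] [DecidableEq α] [Fintype ι]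
    [DecidableEq ι] (a₀ : α → ι) :
    (Finset.univ.filter fun a : α → ι => ∀ i, (Finset.univ.filter fun v => a v = i).card =
      (Finset.univ.filter fun v => a₀ v = i).card).card *
      ∏ i, (Finset.univ.filter fun v => a₀ v = i).card.factorial = (Fintype.card α).factorial := by
  have hcomp : ∀ (g : Equiv.Perm α) (i : ι), (Finset.univ.filter fun v => a₀ (g v) = i).card =
      (Finset.univ.filter fun v => a₀ v = i).card := by
    intro g i
    refine Finset.card_bij (fun v _ => g v) (by simp) (fun _ _ _ _ h => g.injective h) ?_
    exact fun v hv => ⟨g.symm v, by simpa using hv, by simp⟩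
  have hmaps : ∀ g ∈ (Finset.univ : Finset (Equiv.Perm α)), a₀ ∘ g ∈
      Finset.univ.filter fun a : α → ι => ∀ i, (Finset.univ.filter fun v => a v = i).card =
        (Finset.univ.filter fun v => a₀ v = i).card := by
    intro g _
    simpa using hcomp g
  have hstab : (Finset.univ.filter fun g : Equiv.Perm α => a₀ ∘ g = a₀).card =
      ∏ i, (Finset.univ.filter fun v => a₀ v = i).card.factorial := by
    rw [← Fintype.card_subtype, DomMulAct.stabilizer_card]
    simp only [Fintype.card_subtype]
  rw [← Fintype.card_perm, ← Finset.card_univ, Finset.card_eq_sum_card_fiberwise hmaps, ← hstab,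
    Finset.sum_const_nat]
  intro a ha
  have ha' := (Finset.mem_filter.1 ha).2
  -- Bijections between fibres glue to a permutation carrying `a₀` to `a`; translating by it
  -- identifies the permutations sending `a₀` to `a` with the stabilizer.
  have e : ∀ i, {v // a v = i} ≃ {v // a₀ v = i} := fun i =>
    Fintype.equivOfCardEq (by rw [Fintype.card_subtype, Fintype.card_subtype, ha' i])
  let g₀ : Equiv.Perm α := Equiv.ofFiberEquiv e
  have hg₀ : ∀ v, a₀ (g₀ v) = a v := Equiv.ofFiberEquiv_map e
  have hg₀' : ∀ v, a (g₀.symm v) = a₀ v := fun v => by rw [← hg₀, Equiv.apply_symm_apply]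
  refine Finset.card_bij (fun g _ => g₀.symm.trans g) ?_ ?_ ?_
  · intro g hg
    have hg' : a₀ ∘ g = a := (Finset.mem_filter.1 hg).2
    refine Finset.mem_filter.2 ⟨Finset.mem_univ _, funext fun v => ?_⟩
    exact (congrFun hg' (g₀.symm v)).trans (hg₀' v)
  · intro g _ g' _ h
    ext v
    simpa using congrArg (fun h : Equiv.Perm α => h (g₀ v)) h
  · intro g hg
    have hg' : a₀ ∘ g = a₀ := (Finset.mem_filter.1 hg).2
    refine ⟨g₀.trans g, Finset.mem_filter.2 ⟨Finset.mem_univ _, funext fun v => ?_⟩, ?_⟩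
    · exact (congrFun hg' (g₀ v)).trans (hg₀ v)
    · ext v
      simp

/-! ### Laplacians whose weights depend only on classes of vertices. -/

theorem sum_comp_eq_sum_card_mul {V ι R : Type*} [Fintype V] [Fintype ι] [DecidableEq ι]
    [CommSemiring R] (a : V → ι) (f : ι → R) :
    ∑ v, f (a v) = ∑ i, ((Finset.univ.filter fun v => a v = i).card : R) * f i := by
  rw [← Finset.sum_fiberwise Finset.univ a]
  refine Finset.sum_congr rfl fun i _ => ?_
  rw [Finset.sum_congr rfl (g := fun _ => f i) fun v hv => by rw [(Finset.mem_filter.1 hv).2],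
    Finset.sum_const, nsmul_eq_mul]

/-- If the rows of `M` sum to zero, then adding `c` to a column amounts, in the determinant, to
replacing that column by `c`. -/
theorem det_add_col_of_mulVec_one_eq_zero {ι R : Type*} [Fintype ι] [DecidableEq ι] [CommRing R]
    (M : Matrix ι ι R) (hM : ∀ i, ∑ j, M i j = 0) (k : ι) (c : ι → R) :
    (Matrix.of fun i j => M i j + if j = k then c i else 0).det = (M.updateCol k c).det := by
  set B : Matrix ι ι R := Matrix.of fun i j => M i j + if j = k then c i else 0 with hB
  -- Replacing column `k` by the sum of all columns preserves the determinant; the contribution of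
  -- `M` to that sum is zero.
  have h := Matrix.det_updateCol_sum B k (fun _ => 1)
  rw [one_smul] at h
  rw [← h]
  congr 1
  ext i j
  by_cases hj : j = k
  · subst hj
    simp [hB, Finset.sum_add_distrib, hM]
  · simp [hB, hj]

/-- Both sides are the diagonal entry of the adjugate at `k`. -/
theorem det_updateCol_single_self {ι R : Type*} [Fintype ι] [DecidableEq ι] [CommRing R]
    (M : Matrix ι ι R) (k : ι) :
    (M.updateCol k (Pi.single k 1)).det = (M.updateRow k (Pi.single k 1)).det := by
  rw [← Matrix.adjugate_apply, ← Matrix.det_transpose, ← Matrix.updateRow_transpose,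
    ← Matrix.adjugate_apply, ← Matrix.adjugate_transpose]
  rfl

theorem rootedLaplacian_eq_updateRow {ι R : Type*} [Fintype ι] [DecidableEq ι] [CommRing R]
    (w : ι → ι → R) (k : ι) : rootedLaplacian w k =
      (Matrix.of fun i j => (if i = j then ∑ z, w i z else 0) - w i j).updateRow k
        (Pi.single k 1) := by
  ext i j
  by_cases hi : i = k
  · subst hi
    simp [rootedLaplacian, Pi.single_apply, eq_comm]
  · simp [rootedLaplacian, hi]

/-- The matrix on the left is a singular Laplacian with zero row sums, perturbed in column `k`. Up
to the factor `N k`, the perturbation is a multiple of `e_k` minus column `k` of the Laplacian; the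
latter contributes only the zero determinant. -/
theorem mul_det_laplacian_sub_col {ι R : Type*} [Fintype ι] [DecidableEq ι] [CommRing R]
    [IsDomain R] (w : ι → ι → R) (N : ι → R) (k : ι) :
    N k * (Matrix.of fun i j => (if i = j then ∑ z, N z * w i z else 0) -
      w i j * (N j - if j = k then 1 else 0)).det =
      (∑ z, N z * w k z) * (rootedLaplacian (fun i j => N j * w i j) k).det := by
  set M : Matrix ι ι R :=
    Matrix.of fun i j => (if i = j then ∑ z, N z * w i z else 0) - N j * w i j with hMdef
  have hM : ∀ i, ∑ j, M i j = 0 := fun i => by simp [hMdef, Finset.sum_sub_distrib]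
  have hdet : M.det = 0 := by
    rw [← Matrix.exists_mulVec_eq_zero_iff]
    refine ⟨fun _ => 1, fun h => one_ne_zero (congrFun h k), ?_⟩
    ext i
    simpa [Matrix.mulVec, dotProduct] using hM i
  have hB : (Matrix.of fun i j => (if i = j then ∑ z, N z * w i z else 0) -
      w i j * (N j - if j = k then 1 else 0)) =
      Matrix.of fun i j => M i j + if j = k then w i k else 0 := by
    ext i j
    by_cases hj : j = k
    · subst hj
      simp only [hMdef, Matrix.of_apply, if_true]
      ring
    · simp only [hMdef, Matrix.of_apply, hj, if_false]
      ring
  have hcol : (fun i => N k * w i k) =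
      (∑ z, N z * w k z) • Pi.single k 1 + (-1 : R) • fun i => M i k := by
    ext i
    by_cases hi : i = k
    · subst hi
      simp [hMdef]
    · simp [hMdef, hi]
  rw [hB, det_add_col_of_mulVec_one_eq_zero M hM, ← Matrix.det_updateCol_smul,
    rootedLaplacian_eq_updateRow, ← hMdef, ← det_updateCol_single_self]
  change (M.updateCol k (fun i => N k * w i k)).det = _
  rw [hcol, Matrix.det_updateCol_add, Matrix.det_updateCol_smul, Matrix.det_updateCol_smul]
  have hself : M.updateCol k (fun i => M i k) = M := Matrix.updateCol_eq_self M k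
  rw [hself, hdet, mul_zero, add_zero]

/-- A Sylvester-type identity: the Laplacian is `E - P * Q` with `P * Q` factoring through `ι`. The
relation `E * P = P * F` replaces division by `E`, so no `D i` need be invertible. Row `ρ` of `P` is
zero, whence one vertex is removed from the class of the root. -/
theorem det_rootedLaplacian_comp_mul {V ι R : Type*} [Fintype V] [DecidableEq V] [Fintype ι]
    [DecidableEq ι] [CommRing R] (w : ι → ι → R) (a : V → ι) (ρ : V) (D : ι → R)
    (hD : ∀ i, D i = ∑ j, ((Finset.univ.filter fun v => a v = j).card : R) * w i j) :
    (rootedLaplacian (fun u v => w (a u) (a v)) ρ).det * ∏ i, D i =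
      (∏ u with u ≠ ρ, D (a u)) * (Matrix.of fun i j => (if i = j then D i else 0) -
        w i j * (((Finset.univ.filter fun v => a v = j).card : R) -
          if j = a ρ then 1 else 0)).det := by
  let E : Matrix V V R := Matrix.diagonal fun u => if u ≠ ρ then D (a u) else 1
  let P : Matrix V ι R := Matrix.of fun u i => if u ≠ ρ ∧ a u = i then 1 else 0
  let Q : Matrix ι V R := Matrix.of fun i v => w i (a v)
  let F : Matrix ι ι R := Matrix.diagonal D
  have hA : rootedLaplacian (fun u v => w (a u) (a v)) ρ = E - P * Q := by
    ext u v
    by_cases hu : u = ρ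
    · simp [rootedLaplacian, E, P, Q, hu, Matrix.mul_apply, Matrix.diagonal_apply]
    · simp [rootedLaplacian, E, P, Q, hu, Matrix.mul_apply, Matrix.diagonal_apply, hD,
        sum_comp_eq_sum_card_mul a (w (a u))]
  have hQP : (Matrix.of fun i j => (if i = j then D i else 0) -
      w i j * (((Finset.univ.filter fun v => a v = j).card : R) -
        if j = a ρ then 1 else 0)) = F - Q * P := by
    ext i j
    simp only [Matrix.of_apply, Matrix.sub_apply, F, Matrix.diagonal_apply, Matrix.mul_apply, P, Q]
    congr 1
    have h : ∀ v, w i (a v) * (if v ≠ ρ ∧ a v = j then (1 : R) else 0) =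
        w i j * ((if a v = j then 1 else 0) - if v = ρ then (if j = a ρ then 1 else 0) else 0) := by
      intro v
      by_cases hv : v = ρ
      · subst hv
        by_cases hj : a v = j
        · simp [hj]
        · simp [hj, Ne.symm hj]
      · by_cases hj : a v = j
        · simp [hv, hj]
        · simp [hv, hj]
    rw [Finset.sum_congr rfl fun v _ => h v, ← Finset.mul_sum, Finset.sum_sub_distrib,
      Finset.sum_boole, Finset.sum_ite_eq']
    simp
  have hEP : E * P = P * F := by
    ext u i
    simp only [E, P, F, Matrix.diagonal_mul, Matrix.mul_diagonal, Matrix.of_apply]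
    by_cases hu : u = ρ
    · simp [hu]
    · by_cases hi : a u = i <;> simp [hu, hi]
  have hblock : Matrix.fromBlocks E P Q 1 * Matrix.fromBlocks 1 (-P) 0 F =
      Matrix.fromBlocks E 0 Q (F - Q * P) := by
    rw [Matrix.fromBlocks_multiply]
    congr 1
    · simp
    · rw [Matrix.mul_neg, hEP, neg_add_cancel]
    · simp
    · rw [Matrix.mul_neg, Matrix.one_mul, neg_add_eq_sub]
  have hdet := congrArg Matrix.det hblock
  rw [Matrix.det_mul, Matrix.det_fromBlocks_one₂₂, Matrix.det_fromBlocks_zero₂₁,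
    Matrix.det_fromBlocks_zero₁₂, Matrix.det_one, one_mul, Matrix.det_diagonal,
    Matrix.det_diagonal] at hdet
  rw [hA, hQP, hdet, Finset.prod_filter]

theorem map_parentGF {V R R' : Type*} [Fintype V] [DecidableEq V] [CommSemiring R]
    [CommSemiring R'] (φ : R →+* R') (w : V → V → R) (ρ : V) :
    φ (parentGF w ρ) = parentGF (fun u v => φ (w u v)) ρ := by
  simp only [parentGF, map_sum, map_prod]

/-- The column identity supplies the factor `D (a ρ)` missing at the root, which completes the
product to `D i ^ N i` over all classes; cancelling one nonzero `D i` per class leaves the exponent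
`N i - 1`. -/
theorem card_mul_parentGF_comp_of_ne_zero {V ι R : Type*} [Fintype V] [DecidableEq V] [Fintype ι]
    [DecidableEq ι] [CommRing R] [IsDomain R] (w : ι → ι → R) {a : V → ι}
    (ha : Function.Surjective a) (ρ : V) (N : ι → ℕ)
    (hN : ∀ i, (Finset.univ.filter fun v => a v = i).card = N i)
    (hD : ∀ i, ∑ j, (N j : R) * w i j ≠ 0) :
    (N (a ρ) : R) * parentGF (fun u v => w (a u) (a v)) ρ =
      (∏ i, (∑ j, (N j : R) * w i j) ^ (N i - 1)) *
        parentGF (fun i j => (N j : R) * w i j) (a ρ) := by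
  have hpos : ∀ i, 0 < N i := fun i => by
    obtain ⟨v, hv⟩ := ha i
    rw [← hN]
    exact Finset.card_pos.2 ⟨v, by simpa using hv⟩
  set D : ι → R := fun i => ∑ j, (N j : R) * w i j with hDdef
  have h₁ := det_rootedLaplacian_comp_mul w a ρ D (fun i => by simp only [hN, hDdef])
  have h₂ := mul_det_laplacian_sub_col w (fun i => (N i : R)) (a ρ)
  simp only [hN] at h₁
  rw [← det_rootedLaplacian, ← det_rootedLaplacian]
  refine mul_right_cancel₀ (Finset.prod_ne_zero_iff.2 fun i _ => hD i : ∏ i, D i ≠ 0) ?_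
  have hall : (∏ u with u ≠ ρ, D (a u)) * D (a ρ) = (∏ i, D i ^ (N i - 1)) * ∏ i, D i := by
    rw [← Finset.prod_mul_distrib, Finset.filter_ne', Finset.prod_erase_mul _ _ (Finset.mem_univ ρ),
      ← Finset.prod_fiberwise Finset.univ a]
    refine Finset.prod_congr rfl fun i _ => ?_
    rw [Finset.prod_congr rfl (g := fun _ => D i) fun v hv => by rw [(Finset.mem_filter.1 hv).2],
      Finset.prod_const, hN, ← pow_succ, Nat.sub_add_cancel (hpos i)]
  calc (N (a ρ) : R) * (rootedLaplacian (fun u v => w (a u) (a v)) ρ).det * ∏ i, D i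
      = (∏ u with u ≠ ρ, D (a u)) * ((N (a ρ) : R) *
          (Matrix.of fun i j => (if i = j then D i else 0) -
            w i j * ((N j : R) - if j = a ρ then 1 else 0)).det) := by
        rw [mul_assoc, h₁]; ring
    _ = ((∏ u with u ≠ ρ, D (a u)) * D (a ρ)) *
          (rootedLaplacian (fun i j => (N j : R) * w i j) (a ρ)).det := by
        rw [h₂, mul_assoc]
    _ = _ := by rw [hall]; ring

/-- The generating function of the trees rooted at `ρ`, when the weights depend only on the classes
of the vertices, in terms of the trees on the set of classes. -/
theorem card_mul_parentGF_comp {V ι R : Type*} [Fintype V] [DecidableEq V] [Fintype ι]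
    [DecidableEq ι] [CommRing R] [IsDomain R] [CharZero R] (w : ι → ι → R) {a : V → ι}
    (ha : Function.Surjective a) (ρ : V) (N : ι → ℕ)
    (hN : ∀ i, (Finset.univ.filter fun v => a v = i).card = N i) :
    (N (a ρ) : R) * parentGF (fun u v => w (a u) (a v)) ρ =
      (∏ i, (∑ j, (N j : R) * w i j) ^ (N i - 1)) *
        parentGF (fun i j => (N j : R) * w i j) (a ρ) := by
  -- To avoid assuming nonzero out-sums, add `X` to the diagonal weights: the out-sum of `i` then
  -- has `X`-coefficient `N i ≠ 0`. Setting `X = 0` at the end recovers the claim.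
  have hD : ∀ i, ∑ j, (N j : Polynomial R) *
      (Polynomial.C (w i j) + if i = j then Polynomial.X else 0) ≠ 0 := by
    intro i h
    have hcoeff := congrArg (fun p => Polynomial.coeff p 1) h
    obtain ⟨v, hv⟩ := ha i
    have hpos : N i ≠ 0 := by
      rw [← hN]
      exact Finset.card_ne_zero.2 ⟨v, by simpa using hv⟩
    have hterm : ∀ j, ((N j : Polynomial R) *
        (Polynomial.C (w i j) + if i = j then Polynomial.X else 0)).coeff 1 =
        if i = j then (N j : R) else 0 := by
      intro j
      rw [← nsmul_eq_mul, Polynomial.coeff_smul, Polynomial.coeff_add, Polynomial.coeff_C]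
      split_ifs <;> simp_all
    simp only [Polynomial.finsetSum_coeff, hterm, Polynomial.coeff_zero] at hcoeff
    rw [Finset.sum_ite_eq, if_pos (Finset.mem_univ i)] at hcoeff
    exact hpos (Nat.cast_eq_zero.1 hcoeff)
  have h := congrArg (Polynomial.evalRingHom (0 : R))
    (card_mul_parentGF_comp_of_ne_zero _ ha ρ N hN hD)
  simp only [map_mul, map_prod, map_pow, map_sum, map_parentGF, map_natCast, map_add] at h
  simpa [apply_ite] using h

/-! ### Arc sets of trees and parent functions. -/

/-- A loop would be the only arc leaving its vertex, which could then not reach the root. Hence the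
exclusion of loops from `K` costs no tree. -/
theorem IsRootedTree.fst_ne_snd {V : Type*} {ρ : V} {T : Finset (V × V)} (hT : IsRootedTree ρ T)
    {e : V × V} (he : e ∈ T) : e.1 ≠ e.2 := by
  obtain ⟨u, v⟩ := e
  rintro (rfl : u = v)
  have hu : u ≠ ρ := by
    rintro rfl
    exact hT.root_out _ he
  have hstay : ∀ v, Relation.ReflTransGen (fun a b => (a, b) ∈ T) u v → v = u := by
    intro v hv
    induction hv with
    | refl => rfl
    | tail _ h ih =>
      subst ih
      exact (hT.existsUnique_parent _ hu).unique h he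
  exact hu (hstay ρ (hT.reaches_root u)).symm

theorem sum_isRootedTree {V R : Type*} [Fintype V] [DecidableEq V] [CommSemiring R]
    (w : V → V → R) (ρ : V) [DecidablePred (IsRootedTree ρ : Finset (V × V) → Prop)] :
    ∑ T : Finset (V × V) with IsRootedTree ρ T, ∏ e ∈ T, w e.1 e.2 = parentGF w ρ := by
  classical
  let t : (V → V) → Finset (V × V) := fun f =>
    (Finset.univ.filter fun u => u ≠ ρ).image fun u => (u, f u)
  have ht : ∀ f u v, (u, v) ∈ t f ↔ u ≠ ρ ∧ f u = v := by
    intro f u v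
    simp only [t, Finset.mem_image, Finset.mem_filter, Finset.mem_univ, true_and, Prod.mk.injEq]
    constructor
    · rintro ⟨x, hx, rfl, rfl⟩
      exact ⟨hx, rfl⟩
    · rintro ⟨hu, rfl⟩
      exact ⟨u, hu, rfl, rfl⟩
  symm
  refine Finset.sum_bij (fun f _ => t f) ?_ ?_ ?_ ?_
  · intro f hf
    have hf' := (Finset.mem_filter.1 hf).2
    refine Finset.mem_filter.2 ⟨Finset.mem_univ _, fun v hv => ((ht f ρ v).1 hv).1 rfl,
      fun u hu => ⟨f u, (ht f u _).2 ⟨hu, rfl⟩, fun v hv => ((ht f u v).1 hv).2.symm⟩, fun u => ?_⟩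
    obtain ⟨k, hk⟩ := hf'.2 u
    induction k generalizing u with
    | zero => exact hk ▸ Relation.ReflTransGen.refl
    | succ k ih =>
      by_cases hu : u = ρ
      · exact hu ▸ Relation.ReflTransGen.refl
      · exact Relation.ReflTransGen.head ((ht f u _).2 ⟨hu, rfl⟩) (ih (f u) hk)
  · intro f hf g hg hfg
    have hf' := (Finset.mem_filter.1 hf).2
    have hg' := (Finset.mem_filter.1 hg).2
    ext u
    by_cases hu : u = ρ
    · rw [hu, hf'.1, hg'.1]
    · have h := (ht f u (f u)).2 ⟨hu, rfl⟩
      have hfg' : t f = t g := hfg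
      rw [hfg'] at h
      exact ((ht g u _).1 h).2.symm
  · intro T hT
    have hT' := (Finset.mem_filter.1 hT).2
    choose p hp hpu using hT'.existsUnique_parent
    let f : V → V := fun u => if hu : u = ρ then ρ else p u hu
    have hmem : ∀ u v, (u, v) ∈ T ↔ u ≠ ρ ∧ f u = v := by
      intro u v
      by_cases hu : u = ρ
      · subst hu
        simpa using hT'.root_out v
      · simp only [f, dif_neg hu, ne_eq, hu, not_false_eq_true, true_and]
        exact ⟨fun h => (hpu u hu v h).symm, fun h => h ▸ hp u hu⟩
    refine ⟨f, Finset.mem_filter.2 ⟨Finset.mem_univ _, dif_pos rfl, fun u => ?_⟩, ?_⟩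
    · induction hT'.reaches_root u using Relation.ReflTransGen.head_induction_on with
      | refl => exact ⟨0, rfl⟩
      | head h _ ih =>
        obtain ⟨k, hk⟩ := ih
        refine ⟨k + 1, ?_⟩
        rw [Function.iterate_succ_apply, ((hmem _ _).1 h).2, hk]
    · ext ⟨u, v⟩
      rw [ht, hmem]
  · intro f _
    rw [Finset.prod_image]
    exact fun u _ v _ h => (Prod.mk.inj h).1

/-- Restricting to trees whose arcs satisfy `G` amounts to giving the other arcs weight zero. -/
theorem sum_isRootedTree_of_forall {V R : Type*} [Fintype V] [DecidableEq V] [CommSemiring R]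
    (w : V → V → R) (ρ : V) (G : V → V → Prop) [DecidableRel G] (p : Finset (V × V) → Prop)
    [DecidablePred p] (hp : ∀ T, p T ↔ IsRootedTree ρ T ∧ ∀ e ∈ T, G e.1 e.2) :
    ∑ T : Finset (V × V) with p T, ∏ e ∈ T, w e.1 e.2 =
      parentGF (fun u v => if G u v then w u v else 0) ρ := by
  classical
  rw [← sum_isRootedTree, Finset.sum_filter, Finset.sum_filter]
  refine Finset.sum_congr rfl fun T _ => ?_
  by_cases hT : IsRootedTree ρ T
  · by_cases hG : ∀ e ∈ T, G e.1 e.2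
    · rw [if_pos ((hp T).2 ⟨hT, hG⟩), if_pos hT]
      exact Finset.prod_congr rfl fun e he => (if_pos (hG e he)).symm
    · rw [if_neg fun h => hG ((hp T).1 h).2, if_pos hT]
      push Not at hG
      obtain ⟨e, he, hGe⟩ := hG
      exact (Finset.prod_eq_zero he (if_neg hGe)).symm
  · rw [if_neg fun h => hT ((hp T).1 h).1, if_neg hT]

/-! ### The unique contributing tree on the interval of abscissas. -/

/-- The neighbour of `i` in the direction of `0`. -/
def stepTowardZero {ℓ r : ℤ} (hℓ : ℓ ≤ 0) (hr : 0 ≤ r) (i : Finset.Icc ℓ r) : Finset.Icc ℓ r :=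
  ⟨(i : ℤ) - (i : ℤ).sign, by
    obtain ⟨i, hi⟩ := i
    rw [Finset.mem_Icc] at hi ⊢
    rcases lt_trichotomy i 0 with h | h | h
    · simp only [Int.sign_eq_neg_one_of_neg h]; omega
    · simp only [h, Int.sign_zero]; omega
    · simp only [Int.sign_eq_one_of_pos h]; omega⟩

theorem isRootedAt_stepTowardZero {ℓ r : ℤ} (hℓ : ℓ ≤ 0) (hr : 0 ≤ r) :
    IsRootedAt ⟨0, Finset.mem_Icc.2 ⟨hℓ, hr⟩⟩ (stepTowardZero hℓ hr) := by
  refine ⟨Subtype.ext (by simp [stepTowardZero]), fun u => ?_⟩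
  obtain ⟨m, hm⟩ : ∃ m, (u : ℤ).natAbs = m := ⟨_, rfl⟩
  induction m generalizing u with
  | zero => exact ⟨0, Subtype.ext (Int.natAbs_eq_zero.1 hm)⟩
  | succ m ih =>
    obtain ⟨k, hk⟩ := ih (stepTowardZero hℓ hr u) (by
      change ((u : ℤ) - (u : ℤ).sign).natAbs = m
      rcases lt_trichotomy (u : ℤ) 0 with h | h | h
      · rw [Int.sign_eq_neg_one_of_neg h]; omega
      · omega
      · rw [Int.sign_eq_one_of_pos h]; omega)
    exact ⟨k + 1, hk⟩

/-- If no arc jumps by more than one towards `0`, then only one tree on `{ℓ, …, r}` is rooted at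
`0`. -/
theorem parentGF_Icc {ℓ r : ℤ} (hℓ : ℓ ≤ 0) (hr : 0 ≤ r) {R : Type*} [CommSemiring R]
    (W : Finset.Icc ℓ r → Finset.Icc ℓ r → R)
    (hpos : ∀ i j : Finset.Icc ℓ r, (0 : ℤ) < i → W i j ≠ 0 → (i : ℤ) - 1 ≤ j)
    (hneg : ∀ i j : Finset.Icc ℓ r, (i : ℤ) < 0 → W i j ≠ 0 → (j : ℤ) ≤ i + 1) :
    parentGF W ⟨0, Finset.mem_Icc.2 ⟨hℓ, hr⟩⟩ =
      ∏ i with i ≠ ⟨0, Finset.mem_Icc.2 ⟨hℓ, hr⟩⟩, W i (stepTowardZero hℓ hr i) := by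
  classical
  refine Finset.sum_eq_single_of_mem (stepTowardZero hℓ hr)
    (Finset.mem_filter.2 ⟨Finset.mem_univ _, isRootedAt_stepTowardZero hℓ hr⟩) fun f hf hne => ?_
  have hf' := (Finset.mem_filter.1 hf).2
  by_contra h0
  have hW : ∀ u : Finset.Icc ℓ r, (u : ℤ) ≠ 0 → W u (f u) ≠ 0 := by
    intro u hu h
    refine h0 (Finset.prod_eq_zero (Finset.mem_filter.2 ⟨Finset.mem_univ u, ?_⟩) h)
    exact fun h' => hu (congrArg Subtype.val h')
  obtain ⟨u, hu⟩ := Function.ne_iff.1 hne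
  have hu' : (f u : ℤ) ≠ (u : ℤ) - (u : ℤ).sign := fun h => hu (Subtype.ext h)
  obtain ⟨k, hk⟩ := hf'.2 u
  rcases lt_trichotomy (u : ℤ) 0 with h | h | h
  · rw [Int.sign_eq_neg_one_of_neg h] at hu'
    -- Since `f u` is not `u + 1`, it is at most `u`; a point below `u` rises by at most one, so it
    -- cannot jump over `u`. The orbit is trapped on the negative side and misses `0`. The positive
    -- case is symmetric.
    have hclosed : ∀ k, ((f^[k] u : Finset.Icc ℓ r) : ℤ) ≤ u := by
      intro k
      induction k with
      | zero => exact le_rfl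
      | succ k ih =>
        rw [Function.iterate_succ_apply']
        have h1 := hneg _ _ (lt_of_le_of_lt ih h) (hW _ (lt_of_le_of_lt ih h).ne)
        rcases ih.lt_or_eq with h2 | h2
        · omega
        · rw [Subtype.ext h2] at h1 ⊢
          omega
    have := hclosed k
    rw [hk] at this
    exact absurd this (not_le.2 h)
  · have hu0 : u = ⟨0, Finset.mem_Icc.2 ⟨hℓ, hr⟩⟩ := Subtype.ext h
    rw [hu0, hf'.1] at hu'
    simp at hu'
  · rw [Int.sign_eq_one_of_pos h] at hu'
    have hclosed : ∀ k, (u : ℤ) ≤ (f^[k] u : Finset.Icc ℓ r) := by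
      intro k
      induction k with
      | zero => exact le_rfl
      | succ k ih =>
        rw [Function.iterate_succ_apply']
        have h1 := hpos _ _ (lt_of_lt_of_le h ih) (hW _ (lt_of_lt_of_le h ih).ne')
        rcases ih.lt_or_eq with h2 | h2
        · omega
        · rw [← Subtype.ext h2] at h1 ⊢
          omega
    have := hclosed k
    rw [hk] at this
    exact absurd this (not_le.2 h)

open Classical in
/-- The weight of an arc from abscissa `i` to abscissa `j`. -/
noncomputable def stepWeight (S : Set ℤ) (i j : ℤ) : MvPolynomial (ℤ × ℤ) ℚ :=
  if i - j ∈ S then outVar i (i - j) else 0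

theorem outSum_eq_sum (S : Set ℤ) {ℓ r : ℤ} {n : ℤ → ℕ} (hzero : ∀ i, i < ℓ ∨ r < i → n i = 0)
    (i : ℤ) : outSum S n i =
      ∑ j : Finset.Icc ℓ r, (n j : MvPolynomial (ℤ × ℤ) ℚ) * stepWeight S i j := by
  classical
  have hsupp : (Function.support (S.indicator fun s =>
      (n (i - s) : MvPolynomial (ℤ × ℤ) ℚ) * outVar i s)) ⊆
      ((Finset.Icc ℓ r).image fun j => i - j : Finset ℤ) := by
    intro s hs
    rw [Finset.mem_coe, Finset.mem_image]
    refine ⟨i - s, ?_, sub_sub_cancel i s⟩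
    by_contra h
    rw [Finset.mem_Icc, not_and_or, not_le, not_le] at h
    exact hs (by simp [Set.indicator_apply, hzero _ h])
  rw [outSum, finsum_mem_def, finsum_eq_sum_of_support_subset _ hsupp,
    Finset.sum_image fun _ _ _ _ h => sub_right_injective h,
    Finset.sum_coe_sort (Finset.Icc ℓ r)
      (fun j => (n j : MvPolynomial (ℤ × ℤ) ℚ) * stepWeight S i j)]
  refine Finset.sum_congr rfl fun j _ => ?_
  simp only [Set.indicator_apply, stepWeight, sub_sub_cancel, mul_ite, mul_zero]

/-- `max S = 1` bounds the downward jumps from positive abscissas. Upward jumps from negative ones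
are bounded by `min S = -1`, unless `ℓ = 0` and there are none. -/
theorem parentGF_stepWeight {S : Set ℤ} (hS : IsGreatest S 1) {ℓ r : ℤ} (hℓ : ℓ ≤ 0) (hr : 0 ≤ r)
    (hmin : IsLeast S (-1) ∨ ℓ = 0) (n : ℤ → ℕ) :
    parentGF (fun i j : Finset.Icc ℓ r => (n j : MvPolynomial (ℤ × ℤ) ℚ) * stepWeight S i j)
        ⟨0, Finset.mem_Icc.2 ⟨hℓ, hr⟩⟩ =
      (∏ i ∈ Finset.Icc ℓ (-1), (n (i + 1) : MvPolynomial (ℤ × ℤ) ℚ) * outVar i (-1)) *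
        ∏ i ∈ Finset.Icc 1 r, (n (i - 1) : MvPolynomial (ℤ × ℤ) ℚ) * outVar i 1 := by
  classical
  have hmem : ∀ i j, (n j : MvPolynomial (ℤ × ℤ) ℚ) * stepWeight S i j ≠ 0 → i - j ∈ S := by
    intro i j h
    by_contra h'
    exact h (by rw [stepWeight, if_neg h', mul_zero])
  rw [parentGF_Icc hℓ hr]
  · let g : ℤ → MvPolynomial (ℤ × ℤ) ℚ := fun i =>
      (n (i - i.sign) : MvPolynomial (ℤ × ℤ) ℚ) * stepWeight S i (i - i.sign)
    have h1 : (∏ i : Finset.Icc ℓ r with i ≠ ⟨0, Finset.mem_Icc.2 ⟨hℓ, hr⟩⟩,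
        (n (stepTowardZero hℓ hr i) : MvPolynomial (ℤ × ℤ) ℚ) *
          stepWeight S i (stepTowardZero hℓ hr i)) =
        ∏ i ∈ Finset.Icc ℓ (-1) ∪ Finset.Icc 1 r, g i := by
      refine Finset.prod_bij (fun i _ => (i : ℤ)) ?_ (fun _ _ _ _ h => Subtype.ext h) ?_ ?_
      · intro i hi
        have h := (Finset.mem_filter.1 hi).2
        have h' : (i : ℤ) ≠ 0 := fun h0 => h (Subtype.ext h0)
        have hi' := Finset.mem_Icc.1 i.2
        rw [Finset.mem_union, Finset.mem_Icc, Finset.mem_Icc]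
        omega
      · intro i hi
        rw [Finset.mem_union, Finset.mem_Icc, Finset.mem_Icc] at hi
        refine ⟨⟨i, Finset.mem_Icc.2 (by omega)⟩, Finset.mem_filter.2 ⟨Finset.mem_univ _, ?_⟩, rfl⟩
        intro h
        have : i = 0 := congrArg Subtype.val h
        omega
      · intro i _
        rfl
    rw [h1, Finset.prod_union (Finset.disjoint_left.2 fun i hi hi' => by
      rw [Finset.mem_Icc] at hi hi'; omega)]
    congr 1
    · refine Finset.prod_congr rfl fun i hi => ?_
      rw [Finset.mem_Icc] at hi
      have hS' : (-1 : ℤ) ∈ S := (hmin.resolve_right (by omega)).1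
      simp only [g, Int.sign_eq_neg_one_of_neg (show i < 0 by omega), stepWeight, sub_neg_eq_add,
        sub_add_cancel_left, if_pos hS']
    · refine Finset.prod_congr rfl fun i hi => ?_
      rw [Finset.mem_Icc] at hi
      simp only [g, Int.sign_eq_one_of_pos (show 0 < i by omega), stepWeight, sub_sub_cancel,
        if_pos hS.1]
  · intro i j _ h
    have := hS.2 (hmem _ _ h)
    omega
  · intro i j hi h
    rcases hmin with hmin | hmin
    · have := hmin.2 (hmem _ _ h)
      omega
    · have := (Finset.mem_Icc.1 i.2).1
      omega

/-! ### Trees and abscissa functions with a given profile. -/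

theorem HasProfile.mem_Icc {V : Type*} [Fintype V] {a : V → ℤ} {n : ℤ → ℕ} (ha : HasProfile a n)
    {ℓ r : ℤ} (hzero : ∀ i, i < ℓ ∨ r < i → n i = 0) (v : V) : a v ∈ Finset.Icc ℓ r := by
  by_contra h
  rw [Finset.mem_Icc, not_and_or, not_le, not_le] at h
  have h0 := (ha (a v)).trans (hzero _ h)
  exact Finset.card_ne_zero.2 ⟨v, by simp⟩ h0

/-- The common value of `n 0` times the generating functions of the trees of profile `n` rooted at
a given vertex of abscissa `0`. -/
noncomputable def profileProduct (S : Set ℤ) (ℓ r : ℤ) (n : ℤ → ℕ) : MvPolynomial (ℤ × ℤ) ℚ :=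
  (∏ i ∈ Finset.Icc ℓ r, outSum S n i ^ (n i - 1)) *
    ((∏ i ∈ Finset.Icc ℓ (-1), (n (i + 1) : MvPolynomial (ℤ × ℤ) ℚ) * outVar i (-1)) *
      ∏ i ∈ Finset.Icc 1 r, (n (i - 1) : MvPolynomial (ℤ × ℤ) ℚ) * outVar i 1)

theorem card_mul_parentGF_stepWeight {S : Set ℤ} (hS : IsGreatest S 1) {ℓ r : ℤ} (hℓ : ℓ ≤ 0)
    (hr : 0 ≤ r) (hmin : IsLeast S (-1) ∨ ℓ = 0) {n : ℤ → ℕ}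
    (hpos : ∀ i, ℓ ≤ i → i ≤ r → 0 < n i) (hzero : ∀ i, i < ℓ ∨ r < i → n i = 0)
    {V : Type*} [Fintype V] [DecidableEq V] {a : V → ℤ} (ha : HasProfile a n) {ρ : V}
    (hρ : a ρ = 0) :
    (n 0 : MvPolynomial (ℤ × ℤ) ℚ) * parentGF (fun u v => stepWeight S (a u) (a v)) ρ =
      profileProduct S ℓ r n := by
  let b : V → Finset.Icc ℓ r := fun v => ⟨a v, ha.mem_Icc hzero v⟩
  have hb : Function.Surjective b := by
    intro i
    have hi := Finset.mem_Icc.1 i.2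
    have hcard := hpos i hi.1 hi.2
    rw [← ha i, Finset.card_pos] at hcard
    obtain ⟨v, hv⟩ := hcard
    exact ⟨v, Subtype.ext (Finset.mem_filter.1 hv).2⟩
  have hN : ∀ i : Finset.Icc ℓ r, (Finset.univ.filter fun v => b v = i).card = n i := by
    intro i
    rw [← ha i]
    congr 1
    ext v
    simp [b, Subtype.ext_iff]
  have h := card_mul_parentGF_comp (fun i j : Finset.Icc ℓ r => stepWeight S i j) hb ρ
    (fun i => n i) hN
  have hbρ : b ρ = ⟨0, Finset.mem_Icc.2 ⟨hℓ, hr⟩⟩ := Subtype.ext hρ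
  rw [hbρ, parentGF_stepWeight hS hℓ hr hmin] at h
  refine h.trans ?_
  simp only [← outSum_eq_sum S hzero]
  rw [profileProduct, Finset.prod_coe_sort (Finset.Icc ℓ r) fun i => outSum S n i ^ (n i - 1)]

theorem hasProfile_profileVertex {ℓ r : ℤ} {n : ℤ → ℕ}
    (hzero : ∀ i, i < ℓ ∨ r < i → n i = 0) :
    HasProfile (fun v : ProfileVertex ℓ r n => (v.1 : ℤ)) n := by
  intro i
  by_cases hi : i ∈ Finset.Icc ℓ r
  · rw [← Fintype.card_fin (n i), ← Finset.card_univ]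
    symm
    refine Finset.card_bij (fun p _ => (⟨⟨i, hi⟩, p⟩ : ProfileVertex ℓ r n)) (by simp) ?_ ?_
    · intro p _ q _ h
      exact eq_of_heq (Sigma.mk.inj h).2
    · rintro ⟨⟨j, hj⟩, p⟩ h
      obtain rfl : j = i := (Finset.mem_filter.1 h).2
      exact ⟨p, Finset.mem_univ _, rfl⟩
  · rw [Finset.filter_eq_empty_iff.2, Finset.card_empty, hzero]
    · rw [Finset.mem_Icc] at hi
      omega
    · rintro ⟨j, p⟩ _ rfl
      exact hi j.2

theorem spanningTreeGF_profileDigraph (S : Set ℤ) (ℓ r : ℤ) (n : ℤ → ℕ)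
    (ρ : ProfileVertex ℓ r n) :
    spanningTreeGF (profileDigraph S ℓ r n) (fun u v => outVar u.1 (u.1 - v.1)) ρ =
      parentGF (fun u v : ProfileVertex ℓ r n => stepWeight S u.1 v.1) ρ := by
  classical
  refine sum_isRootedTree_of_forall
    (fun u v : ProfileVertex ℓ r n => outVar (u.1 : ℤ) ((u.1 : ℤ) - v.1)) ρ
    (fun u v : ProfileVertex ℓ r n => (u.1 : ℤ) - v.1 ∈ S)
    (IsSpanningTree (profileDigraph S ℓ r n) ρ) fun T => ?_
  refine and_congr_right fun hT => forall₂_congr fun e he => ?_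
  constructor
  · rintro ⟨_, s, hs, h⟩
    rwa [h, sub_sub_cancel]
  · exact fun h => ⟨hT.fst_ne_snd he, _, h, (sub_sub_cancel _ _).symm⟩

theorem card_mul_spanningTreeGF {S : Set ℤ} (hS : IsGreatest S 1) {ℓ r : ℤ} (hℓ : ℓ ≤ 0)
    (hr : 0 ≤ r) (hmin : IsLeast S (-1) ∨ ℓ = 0) {n : ℤ → ℕ}
    (hpos : ∀ i, ℓ ≤ i → i ≤ r → 0 < n i) (hzero : ∀ i, i < ℓ ∨ r < i → n i = 0) :
    (n 0 : MvPolynomial (ℤ × ℤ) ℚ) *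
      spanningTreeGF (profileDigraph S ℓ r n) (fun u v => outVar u.1 (u.1 - v.1))
        (lastZeroVertex hℓ hr (hpos 0 hℓ hr)) = profileProduct S ℓ r n := by
  rw [spanningTreeGF_profileDigraph]
  exact card_mul_parentGF_stepWeight hS hℓ hr hmin hpos hzero (hasProfile_profileVertex hzero) rfl

/-- Exactly `n 0` vertices are admissible as roots, and each contributes the `n 0`-th part of
`profileProduct`. -/
theorem sum_isEmbeddedTree {S : Set ℤ} (hS : IsGreatest S 1) {ℓ r : ℤ} (hℓ : ℓ ≤ 0)
    (hr : 0 ≤ r) (hmin : IsLeast S (-1) ∨ ℓ = 0) {n : ℤ → ℕ}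
    (hpos : ∀ i, ℓ ≤ i → i ≤ r → 0 < n i) (hzero : ∀ i, i < ℓ ∨ r < i → n i = 0)
    {V : Type*} [Fintype V] [DecidableEq V] {a : V → ℤ} (ha : HasProfile a n)
    [∀ ρ, DecidablePred fun T : Finset (V × V) => IsEmbeddedTree S ρ T a] :
    ∑ ρ : V, ∑ T : Finset (V × V) with IsEmbeddedTree S ρ T a,
      ∏ e ∈ T, outVar (a e.1) (a e.1 - a e.2) = profileProduct S ℓ r n := by
  classical
  have hn0 : (n 0 : MvPolynomial (ℤ × ℤ) ℚ) ≠ 0 := Nat.cast_ne_zero.2 (hpos 0 hℓ hr).ne'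
  refine mul_left_cancel₀ hn0 ?_
  have hterm : ∀ ρ, (n 0 : MvPolynomial (ℤ × ℤ) ℚ) *
      ∑ T : Finset (V × V) with IsEmbeddedTree S ρ T a,
        ∏ e ∈ T, outVar (a e.1) (a e.1 - a e.2) =
      if a ρ = 0 then profileProduct S ℓ r n else 0 := by
    intro ρ
    split_ifs with hρ
    · rw [← card_mul_parentGF_stepWeight hS hℓ hr hmin hpos hzero ha hρ]
      congr 1
      exact sum_isRootedTree_of_forall (fun u v => outVar (a u) (a u - a v)) ρ
        (fun u v => a u - a v ∈ S) _ fun T => ⟨fun h => ⟨h.1, h.3⟩, fun h => ⟨h.1, hρ, h.2⟩⟩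
    · rw [Finset.sum_filter, Finset.sum_eq_zero, mul_zero]
      exact fun T _ => if_neg fun h => hρ h.2
  rw [Finset.mul_sum, Finset.sum_congr rfl fun ρ _ => hterm ρ, ← Finset.sum_filter,
    Finset.sum_const, ha 0, nsmul_eq_mul]

theorem card_hasProfile {ℓ r : ℤ} {n : ℤ → ℕ} (hzero : ∀ i, i < ℓ ∨ r < i → n i = 0)
    [DecidablePred fun a : Fin (profileSize ℓ r n) → ℤ => HasProfile a n] :
    ((Fintype.piFinset fun _ : Fin (profileSize ℓ r n) => Finset.Icc ℓ r).filter
      fun a => HasProfile a n).card * ∏ i ∈ Finset.Icc ℓ r, (n i).factorial =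
      (profileSize ℓ r n).factorial := by
  classical
  have hcard : Fintype.card (Fin (profileSize ℓ r n)) = Fintype.card (ProfileVertex ℓ r n) := by
    rw [Fintype.card_fin, Fintype.card_sigma]
    simp only [Fintype.card_fin]
    exact (Finset.sum_coe_sort (Finset.Icc ℓ r) n).symm
  let e := Fintype.equivOfCardEq hcard
  let a₀ : Fin (profileSize ℓ r n) → Finset.Icc ℓ r := fun v => (e v).1
  have ha₀ : ∀ i : Finset.Icc ℓ r, (Finset.univ.filter fun v => a₀ v = i).card = n i := by
    intro i
    rw [← hasProfile_profileVertex hzero i]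
    refine Finset.card_bij (fun v _ => e v) ?_ (fun _ _ _ _ h => e.injective h) ?_
    · intro v hv
      simpa [a₀] using hv
    · intro v hv
      refine ⟨e.symm v, Finset.mem_filter.2 ⟨Finset.mem_univ _, Subtype.ext ?_⟩,
        e.apply_symm_apply v⟩
      change ((e (e.symm v)).1 : ℤ) = i
      rw [e.apply_symm_apply]
      exact (Finset.mem_filter.1 hv).2
  have h := card_filter_card_fiber_eq a₀
  simp only [ha₀] at h
  rw [Finset.prod_coe_sort (Finset.Icc ℓ r) fun i => (n i).factorial, Fintype.card_fin] at h
  rw [← h]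
  congr 1
  symm
  refine Finset.card_bij (fun a _ v => (a v : ℤ)) ?_ ?_ ?_
  · intro a ha
    have ha' := (Finset.mem_filter.1 ha).2
    refine Finset.mem_filter.2 ⟨Fintype.mem_piFinset.2 fun v => (a v).2, fun i => ?_⟩
    by_cases hi : i ∈ Finset.Icc ℓ r
    · rw [← ha' ⟨i, hi⟩]
      simp only [Subtype.ext_iff]
    · rw [Finset.filter_eq_empty_iff.2, Finset.card_empty, hzero]
      · rw [Finset.mem_Icc] at hi
        omega
      · rintro v _ rfl
        exact hi (a v).2
  · intro a _ b _ h
    ext v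
    exact congrFun h v
  · intro a ha
    have ha' := (Finset.mem_filter.1 ha).2
    refine ⟨fun v => ⟨a v, ha'.mem_Icc hzero v⟩, Finset.mem_filter.2 ⟨Finset.mem_univ _, ?_⟩, rfl⟩
    intro i
    rw [← ha' i]
    simp only [Subtype.ext_iff]

theorem embeddedCayleyTreeGF_eq_card_mul {S : Set ℤ} (hS : IsGreatest S 1) {ℓ r : ℤ} (hℓ : ℓ ≤ 0)
    (hr : 0 ≤ r) (hmin : IsLeast S (-1) ∨ ℓ = 0) {n : ℤ → ℕ}
    (hpos : ∀ i, ℓ ≤ i → i ≤ r → 0 < n i) (hzero : ∀ i, i < ℓ ∨ r < i → n i = 0)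
    [DecidablePred fun a : Fin (profileSize ℓ r n) → ℤ => HasProfile a n] :
    embeddedCayleyTreeGF S ℓ r n =
      (((Fintype.piFinset fun _ : Fin (profileSize ℓ r n) => Finset.Icc ℓ r).filter
        fun a => HasProfile a n).card : MvPolynomial (ℤ × ℤ) ℚ) * profileProduct S ℓ r n := by
  classical
  rw [← nsmul_eq_mul, ← Finset.sum_const, Finset.sum_congr rfl fun a ha =>
    (sum_isEmbeddedTree hS hℓ hr hmin hpos hzero (Finset.mem_filter.1 ha).2).symm,
    Finset.sum_comm, embeddedCayleyTreeGF]
  refine Finset.sum_congr rfl fun ρ _ => ?_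
  simp only [Finset.sum_filter]
  rw [Finset.sum_comm]
  refine Finset.sum_congr rfl fun a _ => ?_
  by_cases ha : HasProfile a n
  · simp only [ha, and_true, if_true]
  · simp only [ha, and_false, if_false, Finset.sum_const_zero]

/-! ### Rearranging the products and conclusion. -/

/-- The two shifted products run over `ℓ + 1, …, 0` and `0, …, r - 1`: the ends `ℓ` and `r` are
missing and, once they are restored, `0` is counted twice. -/
theorem prod_Icc_shift_mul {M : Type*} [CommMonoid M] {ℓ r : ℤ} (hℓ : ℓ ≤ 0) (hr : 0 ≤ r)
    (g : ℤ → M) :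
    ((∏ i ∈ Finset.Icc ℓ (-1), g (i + 1)) * ∏ i ∈ Finset.Icc 1 r, g (i - 1)) * (g ℓ * g r) =
      g 0 * ∏ i ∈ Finset.Icc ℓ r, g i := by
  have h1 : (∏ i ∈ Finset.Icc ℓ (-1), g (i + 1)) * g ℓ = ∏ i ∈ Finset.Icc ℓ 0, g i := by
    have hset : Finset.Icc ℓ 0 = insert ℓ ((Finset.Icc ℓ (-1)).image (· + 1)) := by
      ext i
      simp only [Finset.mem_insert, Finset.mem_image, Finset.mem_Icc]
      exact ⟨fun h => or_iff_not_imp_left.2 fun _ => ⟨i - 1, by omega, by omega⟩,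
        by rintro (h | ⟨j, h, rfl⟩) <;> omega⟩
    rw [hset, Finset.prod_insert, Finset.prod_image fun _ _ _ _ h => add_left_injective 1 h,
      mul_comm]
    simp only [Finset.mem_image, Finset.mem_Icc, not_exists, not_and]
    omega
  have h2 : (∏ i ∈ Finset.Icc 1 r, g (i - 1)) * g r = ∏ i ∈ Finset.Icc 0 r, g i := by
    have hset : Finset.Icc 0 r = insert r ((Finset.Icc 1 r).image (· - 1)) := by
      ext i
      simp only [Finset.mem_insert, Finset.mem_image, Finset.mem_Icc]
      exact ⟨fun h => or_iff_not_imp_left.2 fun _ => ⟨i + 1, by omega, by omega⟩,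
        by rintro (h | ⟨j, h, rfl⟩) <;> omega⟩
    rw [hset, Finset.prod_insert, Finset.prod_image fun _ _ _ _ h => sub_left_injective h,
      mul_comm]
    simp only [Finset.mem_image, Finset.mem_Icc, not_exists, not_and]
    omega
  have h3 : Finset.Icc 0 r = insert 0 (Finset.Icc 1 r) := by
    ext i
    simp only [Finset.mem_insert, Finset.mem_Icc]
    omega
  have h4 : Finset.Icc ℓ r = Finset.Icc ℓ 0 ∪ Finset.Icc 1 r := by
    ext i
    simp only [Finset.mem_union, Finset.mem_Icc]
    omega
  rw [mul_mul_mul_comm, h1, h2, h3, Finset.prod_insert (by simp), h4, Finset.prod_union,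
    mul_left_comm]
  exact Finset.disjoint_left.2 fun i hi hi' => by rw [Finset.mem_Icc] at hi hi'; omega

theorem prod_Icc_eq_mul_mul {M : Type*} [CommMonoid M] {ℓ r : ℤ} (h : ℓ < r) (g : ℤ → M) :
    ∏ i ∈ Finset.Icc ℓ r, g i = (g ℓ * g r) * ∏ i ∈ Finset.Icc (ℓ + 1) (r - 1), g i := by
  have hset : Finset.Icc ℓ r = insert ℓ (insert r (Finset.Icc (ℓ + 1) (r - 1))) := by
    ext i
    simp only [Finset.mem_insert, Finset.mem_Icc]
    omega
  rw [hset, Finset.prod_insert, Finset.prod_insert, mul_assoc]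
  · simp
  · simp only [Finset.mem_insert, Finset.mem_Icc]
    omega

theorem mul_profileProduct (S : Set ℤ) {ℓ r : ℤ} (hℓ : ℓ ≤ 0) (hr : 0 ≤ r) (n : ℤ → ℕ) :
    ((n ℓ : MvPolynomial (ℤ × ℤ) ℚ) * n r) * profileProduct S ℓ r n =
      ((n 0 : MvPolynomial (ℤ × ℤ) ℚ) * ∏ i ∈ Finset.Icc ℓ r, (n i : MvPolynomial (ℤ × ℤ) ℚ)) *
        ((∏ i ∈ Finset.Icc ℓ (-1), outVar i (-1)) * (∏ i ∈ Finset.Icc 1 r, outVar i 1) *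
          ∏ i ∈ Finset.Icc ℓ r, outSum S n i ^ (n i - 1)) := by
  rw [← prod_Icc_shift_mul hℓ hr fun i => (n i : MvPolynomial (ℤ × ℤ) ℚ), profileProduct,
    Finset.prod_mul_distrib, Finset.prod_mul_distrib]
  ring

theorem mainTheorem11 (S : Set ℤ) (hS : IsGreatest S 1) (ℓ r : ℤ) (hℓ : ℓ ≤ 0) (hr : 0 ≤ r)
    (hmin : IsLeast S (-1) ∨ ℓ = 0) (n : ℤ → ℕ)
    (hpos : ∀ i, ℓ ≤ i → i ≤ r → 0 < n i) (hzero : ∀ i, i < ℓ ∨ r < i → n i = 0) :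
    (ℓ < r →
      spanningTreeGF (profileDigraph S ℓ r n) (fun u v => outVar u.1 (u.1 - v.1))
          (lastZeroVertex hℓ hr (hpos 0 hℓ hr)) =
        (∏ i ∈ Finset.Icc ℓ (-1), outVar i (-1)) * (∏ i ∈ Finset.Icc 1 r, outVar i 1) *
          (∏ i ∈ Finset.Icc (ℓ + 1) (r - 1), (n i : MvPolynomial (ℤ × ℤ) ℚ)) *
          ∏ i ∈ Finset.Icc ℓ r, outSum S n i ^ (n i - 1)) ∧
    (ℓ = r →
      (n 0 : MvPolynomial (ℤ × ℤ) ℚ) *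
          spanningTreeGF (profileDigraph S ℓ r n) (fun u v => outVar u.1 (u.1 - v.1))
            (lastZeroVertex hℓ hr (hpos 0 hℓ hr)) =
        outSum S n 0 ^ (n 0 - 1)) ∧
    embeddedCayleyTreeGF S ℓ r n =
      MvPolynomial.C ((n 0 : ℚ) / (n ℓ * n r) *
          ((profileSize ℓ r n).factorial / ∏ i ∈ Finset.Icc ℓ r, ((n i - 1).factorial : ℚ))) *
        (∏ i ∈ Finset.Icc ℓ (-1), outVar i (-1)) * (∏ i ∈ Finset.Icc 1 r, outVar i 1) *
        ∏ i ∈ Finset.Icc ℓ r, outSum S n i ^ (n i - 1) := by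
  classical
  have hn : ∀ i, ℓ ≤ i → i ≤ r → (n i : MvPolynomial (ℤ × ℤ) ℚ) ≠ 0 :=
    fun i h h' => Nat.cast_ne_zero.2 (hpos i h h').ne'
  have hnℓr := mul_ne_zero (hn ℓ le_rfl (hℓ.trans hr)) (hn r (hℓ.trans hr) le_rfl)
  have hGF := card_mul_spanningTreeGF hS hℓ hr hmin hpos hzero
  have hprod := mul_profileProduct S hℓ hr n
  refine ⟨fun hlt => ?_, fun heq => ?_, ?_⟩
  · refine mul_left_cancel₀ (mul_ne_zero hnℓr (hn 0 hℓ hr)) ?_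
    rw [mul_assoc _ (n 0 : MvPolynomial (ℤ × ℤ) ℚ), hGF, hprod, prod_Icc_eq_mul_mul hlt]
    ring
  · obtain rfl : ℓ = 0 := by omega
    subst heq
    rw [hGF, profileProduct]
    simp
  · refine mul_left_cancel₀ hnℓr ?_
    rw [embeddedCayleyTreeGF_eq_card_mul hS hℓ hr hmin hpos hzero, mul_left_comm, hprod]
    set A := ((Fintype.piFinset fun _ : Fin (profileSize ℓ r n) => Finset.Icc ℓ r).filter
      fun a => HasProfile a n).card with hA
    -- Splitting each `n i !` as `n i * (n i - 1)!` lets the factors `n i` cancel those coming from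
    -- the interval tree.
    have hcard : (A : ℚ) * ((∏ i ∈ Finset.Icc ℓ r, (n i : ℚ)) *
        ∏ i ∈ Finset.Icc ℓ r, ((n i - 1).factorial : ℚ)) = (profileSize ℓ r n).factorial := by
      rw [← card_hasProfile hzero, ← hA, ← Finset.prod_mul_distrib]
      push_cast
      congr 1
      refine Finset.prod_congr rfl fun i hi => ?_
      rw [Finset.mem_Icc] at hi
      exact_mod_cast Nat.mul_factorial_pred (hpos i hi.1 hi.2).ne'
    have hℓ0 : (n ℓ : ℚ) ≠ 0 := Nat.cast_ne_zero.2 (hpos ℓ le_rfl (hℓ.trans hr)).ne'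
    have hr0 : (n r : ℚ) ≠ 0 := Nat.cast_ne_zero.2 (hpos r (hℓ.trans hr) le_rfl).ne'
    have hfac : ∏ i ∈ Finset.Icc ℓ r, ((n i - 1).factorial : ℚ) ≠ 0 :=
      Finset.prod_ne_zero_iff.2 fun i _ => Nat.cast_ne_zero.2 (Nat.factorial_ne_zero _)
    have hcoeff : (A : ℚ) * (n 0 * ∏ i ∈ Finset.Icc ℓ r, (n i : ℚ)) =
        n ℓ * n r * ((n 0 : ℚ) / (n ℓ * n r) *
          ((profileSize ℓ r n).factorial /
            ∏ i ∈ Finset.Icc ℓ r, ((n i - 1).factorial : ℚ))) := by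
      rw [← hcard]
      field_simp
    have hcoeff' := congrArg (MvPolynomial.C (σ := ℤ × ℤ)) hcoeff
    simp only [map_mul, map_natCast, map_prod] at hcoeff'
    simp only [map_mul]
    rw [← mul_assoc, hcoeff']
    ring
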